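/- Affine continuous logic over a Lipschitz language $L$: every function symbol $F$ and every relation symbol $R$ carries a Lipschitz constant $\lambda_F,\lambda_R\ge 0$. An $L$-structure is a nonempty complete metric space $(M,d)$ with $d\le 1$ together with $\lambda_F$-Lipschitz interpretations $F^M:M^k\to M$ and $\lambda_R$-Lipschitz interpretations $R^M:M^k\to[0,1]$, where $M^k$ carries the metric $d(\bar x,\bar y)=\sum_i d(x_i,y_i)$. Affine formulas are built from $1$ and the atomic formulas $R(t_1,\dots,t_k)$ and $d(t_1,t_2)$ by addition, multiplication by real numbers, $\inf_x$ and $\sup_x$. A theory is a set of conditions $\varphi\le\psi$ between sentences; it is complete if for each sentence $\varphi$ there is a unique real $r$ such that $\varphi=r$ in all its models. For $A\subseteq M$, an $n$-type over $A$ is identified with the corresponding functional: a positive linear functional $p$ with $p(1)=1$ on the ordered vector space of formulas $\varphi(x_1,\dots,x_n)$ with parameters in $A$, modulo equality of their values on $M^n$. It is extreme if it is an extreme point of the convex set $S_n(A)$ of all these functionals, and it is realized by $\bar b\in M^n$ if $p(\varphi)=\varphi^M(\bar b)$ for all $\varphi$. $M$ is extremally $\aleph_0$-saturated if for every finite $A\subseteq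 M$ and every $n$, each extreme type in $S_n(A)$ is realized in $M$. A predicate $P:M^n\to\mathbb R$ is definable if it is the uniform limit of a sequence $\varphi_k^M$ with $\varphi_k(x_1,\dots,x_n)$ affine formulas without parameters. A set $D\subseteq M^n$ is definable if it is closed and $d(\bar x,D)=\inf_{\bar a\in D}d(\bar x,\bar a)$ is a definable predicate. An end-set is a set of the form $\{\bar x\in M^n: P(\bar x)=r\}$, where $P$ is a definable predicate and $r$ is either $\inf_{M^n} P$ or $\sup_{M^n} P$. Theorem. Let $T$ be a complete theory in a Lipschitz language that has a compact model, and let $M\models T$ be extremally $\aleph_0$-saturated. Let $n\ge 0$. (1) A nonempty set $D\subseteq M^n$ is definable if and only if there is a definable predicate $P:M^n\to[0,\infty)$ such that $D=Z(P)=\{\bar x: P(\bar x)=0\}$. (2) The nonempty definable subsets of $M^n$ are exactly the end-sets of definable predicates $P:M^n\to\mathbb R$. -/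

import Mathlib

open scoped NNReal Cardinal

universe u v w w'

namespace AffineLogic

/-- A Lipschitz language: a first order language in which every function symbol and every
relation symbol carries a Lipschitz constant. Constant symbols are the `0`-ary function symbols.
The metric symbol is a logical symbol, built into the formulas below. -/
structure LipschitzLanguage extends FirstOrder.Language.{u, v} where
  /-- Lipschitz constants of the function symbols -/
  funConst : ∀ {k : ℕ}, Functions k → ℝ≥0
  /-- Lipschitz constants of the relation symbols -/
  relConst : ∀ {k : ℕ}, Relations k → ℝ≥0

/-- The metric `∑ i, d (x i) (y i)` used on `M ^ n`. It induces the product topology. -/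
noncomputable def tupleDist {M : Type w} [MetricSpace M] {n : ℕ} (x y : Fin n → M) : ℝ :=
  ∑ i, dist (x i) (y i)

/-- An `L`-structure: a nonempty complete metric space with metric bounded by `1`, with
interpretations of the symbols of `L` that respect the Lipschitz constants, relations taking
values in `[0, 1]`. -/
class LipStructure (L : LipschitzLanguage.{u, v}) (M : Type w) [MetricSpace M] where
  nonempty : Nonempty M
  complete : CompleteSpace M
  dist_le_one : ∀ x y : M, dist x y ≤ 1
  funMap : ∀ {k : ℕ}, L.Functions k → (Fin k → M) → M
  funMap_lipschitz : ∀ {k : ℕ} (F : L.Functions k) (x y : Fin k → M),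
    dist (funMap F x) (funMap F y) ≤ L.funConst F * tupleDist x y
  relMap : ∀ {k : ℕ}, L.Relations k → (Fin k → M) → ℝ
  relMap_mem : ∀ {k : ℕ} (R : L.Relations k) (x : Fin k → M), relMap R x ∈ Set.Icc (0 : ℝ) 1
  relMap_lipschitz : ∀ {k : ℕ} (R : L.Relations k) (x y : Fin k → M),
    |relMap R x - relMap R y| ≤ L.relConst R * tupleDist x y

/-- The value of a term in a structure. -/
def termValue {L : LipschitzLanguage.{u, v}} {M : Type w} [MetricSpace M] [LipStructure L M]
    {β : Type w'} (e : β → M) : L.toLanguage.Term β → M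
  | .var b => e b
  | .func F ts => LipStructure.funMap (L := L) F fun i => termValue e (ts i)

/-- Affine formulas `φ(x₀, …, xₙ₋₁)` of `L` with parameters (new constants) from `α`.
A quantifier binds the last of the `n + 1` variables of the formula under it. -/
inductive Formula (L : LipschitzLanguage.{u, v}) (α : Type w) : ℕ → Type (max u v w)
  | one {n : ℕ} : Formula L α n
  | rel {n k : ℕ} (R : L.Relations k) (ts : Fin k → L.toLanguage.Term (α ⊕ Fin n)) :
      Formula L α n
  | metric {n : ℕ} (t s : L.toLanguage.Term (α ⊕ Fin n)) : Formula L α n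
  | smul {n : ℕ} (r : ℝ) (φ : Formula L α n) : Formula L α n
  | add {n : ℕ} (φ ψ : Formula L α n) : Formula L α n
  | inf {n : ℕ} (φ : Formula L α (n + 1)) : Formula L α n
  | sup {n : ℕ} (φ : Formula L α (n + 1)) : Formula L α n

/-- The value `φ^M(x)`, where `v` interprets the parameters. Values of a formula in a structure
are bounded (see `Formula.exists_bound`), so the infima and suprema are genuine ones. -/
noncomputable def Formula.value {L : LipschitzLanguage.{u, v}} {α : Type w'} {M : Type w}
    [MetricSpace M] [LipStructure L M] (v : α → M) :
    {n : ℕ} → Formula L α n → (Fin n → M) → ℝ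
  | _, .one, _ => 1
  | _, .rel R ts, x => LipStructure.relMap (L := L) R fun i => termValue (Sum.elim v x) (ts i)
  | _, .metric t s, x => dist (termValue (Sum.elim v x) t) (termValue (Sum.elim v x) s)
  | _, .smul r φ, x => r * φ.value v x
  | _, .add φ ψ, x => φ.value v x + ψ.value v x
  | _, .inf φ, x => ⨅ y : M, φ.value v (Fin.snoc x y)
  | _, .sup φ, x => ⨆ y : M, φ.value v (Fin.snoc x y)

theorem Formula.exists_bound {L : LipschitzLanguage.{u, v}} {α : Type w'} {M : Type w}
    [MetricSpace M] [LipStructure L M] (v : α → M) {n : ℕ} (φ : Formula L α n) :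
    ∃ b : ℝ, ∀ x : Fin n → M, |φ.value v x| ≤ b := by
  have hne : Nonempty M := LipStructure.nonempty L
  induction φ with
  | one => exact ⟨1, fun x => by simp [Formula.value]⟩
  | rel R ts =>
    refine ⟨1, fun x => ?_⟩
    have h := LipStructure.relMap_mem (L := L) R fun i => termValue (Sum.elim v x) (ts i)
    simp only [Formula.value]
    rw [abs_of_nonneg h.1]
    exact h.2
  | metric t s =>
    refine ⟨1, fun x => ?_⟩
    simp only [Formula.value]
    rw [abs_of_nonneg dist_nonneg]
    exact LipStructure.dist_le_one L _ _
  | smul r φ ih =>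
    obtain ⟨b, hb⟩ := ih
    refine ⟨|r| * b, fun x => ?_⟩
    simp only [Formula.value]
    rw [abs_mul]
    exact mul_le_mul_of_nonneg_left (hb x) (abs_nonneg r)
  | add φ ψ ih1 ih2 =>
    obtain ⟨b, hb⟩ := ih1
    obtain ⟨c, hc⟩ := ih2
    refine ⟨b + c, fun x => ?_⟩
    simp only [Formula.value]
    exact (abs_add_le _ _).trans (add_le_add (hb x) (hc x))
  | inf φ ih =>
    obtain ⟨b, hb⟩ := ih
    refine ⟨b, fun x => ?_⟩
    simp only [Formula.value]
    have hbd : BddBelow (Set.range fun y : M => φ.value v (Fin.snoc x y)) :=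
      ⟨-b, by rintro _ ⟨y, rfl⟩; exact (abs_le.1 (hb _)).1⟩
    exact abs_le.2 ⟨le_ciInf fun y => (abs_le.1 (hb _)).1,
      (ciInf_le hbd hne.some).trans (abs_le.1 (hb _)).2⟩
  | sup φ ih =>
    obtain ⟨b, hb⟩ := ih
    refine ⟨b, fun x => ?_⟩
    simp only [Formula.value]
    have hbd : BddAbove (Set.range fun y : M => φ.value v (Fin.snoc x y)) :=
      ⟨b, by rintro _ ⟨y, rfl⟩; exact (abs_le.1 (hb _)).2⟩
    exact abs_le.2 ⟨(abs_le.1 (hb _)).1.trans (le_ciSup hbd hne.some),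
      ciSup_le fun y => (abs_le.1 (hb _)).2⟩

/-- The value `φ^M(x)` of a formula without parameters. -/
noncomputable def Formula.interp {L : LipschitzLanguage.{u, v}} {n : ℕ} (φ : Formula L Empty n)
    (M : Type w) [MetricSpace M] [LipStructure L M] (x : Fin n → M) : ℝ :=
  φ.value (fun e => e.elim) x

/-- Sentences: formulas without parameters and without free variables. -/
abbrev Sentence (L : LipschitzLanguage.{u, v}) := Formula L Empty 0

/-- A theory is a set of closed conditions; the pair `(φ, ψ)` stands for `φ ≤ ψ`. -/
abbrev Theory (L : LipschitzLanguage.{u, v}) := Set (Sentence L × Sentence L)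

/-- `M ⊨ T`. -/
def IsModel {L : LipschitzLanguage.{u, v}} (T : Theory L) (M : Type w) [MetricSpace M]
    [LipStructure L M] : Prop :=
  ∀ c ∈ T, c.1.interp M Fin.elim0 ≤ c.2.interp M Fin.elim0

/-- `T` is complete: for each sentence `φ` there is a unique `r` with `T ⊨ φ = r`. Uniqueness
makes `T` satisfiable. -/
def IsCompleteTheory {L : LipschitzLanguage.{u, v}} (T : Theory L) : Prop :=
  ∀ φ : Sentence L, ∃! r : ℝ, ∀ (N : Type w) [MetricSpace N] [LipStructure L N],
    IsModel T N → φ.interp N Fin.elim0 = r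

/-- `T` has a model whose underlying metric space is compact. -/
def HasCompactModel {L : LipschitzLanguage.{u, v}} (T : Theory L) : Prop :=
  ∃ (K : Type w) (_ : MetricSpace K) (_ : LipStructure L K), CompactSpace K ∧ IsModel T K

section InStructure

variable (L : LipschitzLanguage.{u, v}) {M : Type w} [MetricSpace M] [LipStructure L M]

/-- The space `S_n(A)` of `n`-types over `A ⊆ M`. A type is identified with the function
`φ ↦ p(φ)` giving the unique `r` such that the condition `φ = r` belongs to `p`; these functions
are the positive normalized linear functionals on the ordered vector space of formulas `φ(x)` with
parameters in `A`, modulo equivalence in the complete theory of `(M, a)_{a ∈ A}`. Monotonicity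
includes that `p` respects this equivalence. -/
def typeSpace (A : Set M) (n : ℕ) : Set (Formula L A n → ℝ) :=
  {p | p .one = 1 ∧
    (∀ φ ψ, p (.add φ ψ) = p φ + p ψ) ∧
    (∀ (r : ℝ) φ, p (.smul r φ) = r * p φ) ∧
    ∀ φ ψ : Formula L A n,
      (∀ x : Fin n → M, φ.value Subtype.val x ≤ ψ.value Subtype.val x) → p φ ≤ p ψ}

/-- The type `tp(b / A)` of a tuple `b` of elements of `M`. -/
noncomputable def tp (A : Set M) {n : ℕ} (b : Fin n → M) : Formula L A n → ℝ :=
  fun φ => φ.value Subtype.val b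

variable (M) in
/-- `M` is extremally `κ`-saturated: for every `A ⊆ M` with fewer than `κ` elements, every
extreme type over `A` is realized in `M`. -/
def IsExtremallySaturated (κ : Cardinal.{w}) : Prop :=
  ∀ A : Set M, #A < κ → ∀ n : ℕ, ∀ p ∈ Set.extremePoints ℝ (typeSpace L A n),
    ∃ b : Fin n → M, tp L A b = p

/-- A predicate on `M ^ n` is definable (without parameters) if it is a uniform limit of a
sequence of formulas. -/
def IsDefinablePred {n : ℕ} (P : (Fin n → M) → ℝ) : Prop :=
  ∃ φ : ℕ → Formula L Empty n,
    TendstoUniformly (fun k x => (φ k).interp M x) P Filter.atTop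

open Classical in
/-- `d(x, D) = inf_{a ∈ D} d(x, a)`; for empty `D` the infimum is the norm of `d` on
`M ^ n × M ^ n`, by convention. -/
noncomputable def distTo {n : ℕ} (D : Set (Fin n → M)) (x : Fin n → M) : ℝ :=
  if D.Nonempty then ⨅ a : D, tupleDist x a
  else ⨆ z : (Fin n → M) × (Fin n → M), tupleDist z.1 z.2

/-- A set `D ⊆ M ^ n` is definable if it is closed and `d(x, D)` is a definable predicate. -/
def IsDefinableSet {n : ℕ} (D : Set (Fin n → M)) : Prop :=
  IsClosed D ∧ IsDefinablePred L (distTo D)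

/-- An end-set of a definable predicate `P`: the set of points at which `P` takes the value
`inf P`, or the set of points at which it takes the value `sup P`. -/
def IsEndSet {n : ℕ} (D : Set (Fin n → M)) : Prop :=
  ∃ P : (Fin n → M) → ℝ, IsDefinablePred L P ∧
    (D = {x | P x = ⨅ y, P y} ∨ D = {x | P x = ⨆ y, P y})

end InStructure

end AffineLogic

open AffineLogic

/-!
The heart of the matter is that for a definable predicate `P ≥ 0` with nonempty zero set `Z` the
distance `d(x, Z)` is definable. It is the limit, as `k → ∞`, of the definable predicates
`P_k(x) = inf_y (k P(y) + d(x, y)) ≤ d(x, Z)`, and two facts have to be proved.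

* *The limit is `d(x, Z)`.* Fix `a` in `M ^ n` and let `y_k` almost realize the infimum in `P_k(a)`.
  Then `P(y_k) → 0`, and the types of the `y_k` over `a` accumulate at a type that vanishes at `P`
  and gives `d(a, y)` at most the value `lim P_k(a)`. As `P ≥ 0`, the types vanishing at `P` form a
  closed face of the compact space of types (`isExtreme_zeroTypes`). The types in it at which
  `d(a, y)` is minimal form again a closed face, which has an extreme point by the Krein–Milman
  theorem; extremal saturation realizes it by an element of `Z` at distance at most `lim P_k(a)`
  from `a` (`exists_eq_zero_and_tupleDist_le`).
* *The convergence is uniform*, at least along a subsequence. In a compact model this is the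
  Arzelà–Ascoli theorem, the `P_k` being bounded and equi-Lipschitz. Since `sup_x (φ - ψ)` is
  expressed by a sentence, and sentences have the same value in all models of a complete theory, a
  sequence of formulas that is uniformly Cauchy in the compact model is uniformly Cauchy in `M`
  (`exists_subseq_tendstoUniformly`). The argument is therefore run with formulas approximating
  the `P_k`.

Conversely a nonempty closed `D` is the zero set of `d(x, D)`. The zero set of a nonnegative
predicate, if nonempty, is the set where its infimum is attained, and an end-set is the zero set of
`P - inf P` or of `sup P - P`; it is nonempty by extremal saturation over the empty set
(`IsDefinablePred.exists_eq_iInf`).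
-/

open Filter Topology

namespace AffineLogic

/-! ### Syntactic operations on affine formulas -/

section AffineFormula

variable {L : LipschitzLanguage.{u, v}} {α : Type*} {β : Type*} {M : Type w}
  [MetricSpace M] [LipStructure L M]

theorem termValue_relabel {γ δ : Type*} (h : γ → δ) (e : δ → M) (t : L.toLanguage.Term γ) :
    termValue (L := L) e (t.relabel h) = termValue (L := L) (e ∘ h) t := by
  induction t with
  | var b => rfl
  | func F ts ih => simp only [FirstOrder.Language.Term.relabel, termValue, ih]

/-- Rename the parameters of a formula along `g` and its free variables along `f`. -/
def Formula.relabel (g : α → β) :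
    {n m : ℕ} → (Fin n → Fin m) → Formula L α n → Formula L β m
  | _, _, _, .one => .one
  | _, _, f, .rel R ts => .rel R fun i => (ts i).relabel (Sum.map g f)
  | _, _, f, .metric t s => .metric (t.relabel (Sum.map g f)) (s.relabel (Sum.map g f))
  | _, _, f, .smul r φ => .smul r (φ.relabel g f)
  | _, _, f, .add φ ψ => .add (φ.relabel g f) (ψ.relabel g f)
  | _, _, f, .inf φ => .inf (φ.relabel g (Fin.snoc (Fin.castSucc ∘ f) (Fin.last _)))
  | _, _, f, .sup φ => .sup (φ.relabel g (Fin.snoc (Fin.castSucc ∘ f) (Fin.last _)))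

theorem snoc_comp_snoc_castSucc {N : Type*} {n m : ℕ} (f : Fin n → Fin m) (x : Fin m → N) (y : N) :
    (Fin.snoc x y : Fin (m + 1) → N) ∘
        (Fin.snoc (Fin.castSucc ∘ f) (Fin.last _) : Fin (n + 1) → Fin (m + 1)) =
      Fin.snoc (x ∘ f) y := by
  funext i
  refine Fin.lastCases ?_ (fun i => ?_) i <;> simp

theorem Formula.value_relabel (g : α → β) (v : β → M) {n m : ℕ} (f : Fin n → Fin m)
    (φ : Formula L α n) (x : Fin m → M) :
    (φ.relabel g f).value v x = φ.value (v ∘ g) (x ∘ f) := by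
  induction φ generalizing m with
  | one => rfl
  | rel R ts => simp only [relabel, value, termValue_relabel, Sum.elim_comp_map]
  | metric t s => simp only [relabel, value, termValue_relabel, Sum.elim_comp_map]
  | smul r φ ih => simp only [relabel, value, ih]
  | add φ ψ ih1 ih2 => simp only [relabel, value, ih1, ih2]
  | inf φ ih => simp only [relabel, value, ih, snoc_comp_snoc_castSucc]
  | sup φ ih => simp only [relabel, value, ih, snoc_comp_snoc_castSucc]

/-- The formula `∑ i, d (t i) (s i)`. -/
def Formula.tupleMetric {n : ℕ} : {k : ℕ} → (t s : Fin k → L.toLanguage.Term (α ⊕ Fin n)) →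
    Formula L α n
  | 0, _, _ => .smul 0 .one
  | _ + 1, t, s => .add (tupleMetric (fun i => t i.castSucc) fun i => s i.castSucc)
      (.metric (t (Fin.last _)) (s (Fin.last _)))

theorem Formula.value_tupleMetric (v : α → M) {n k : ℕ}
    (t s : Fin k → L.toLanguage.Term (α ⊕ Fin n)) (x : Fin n → M) :
    (tupleMetric t s).value v x =
      tupleDist (fun i => termValue (L := L) (Sum.elim v x) (t i))
        fun i => termValue (L := L) (Sum.elim v x) (s i) := by
  induction k with
  | zero => simp [tupleMetric, value, tupleDist]
  | succ k ih => simp [tupleMetric, value, ih, tupleDist, Fin.sum_univ_castSucc]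

/-- Quantify the last `n` variables of a formula by `inf`. -/
def Formula.infTuple {m : ℕ} : (n : ℕ) → Formula L α (m + n) → Formula L α m
  | 0, φ => φ
  | n + 1, φ => infTuple n (.inf φ)

theorem Formula.isGLB_infTuple (v : α → M) {m n : ℕ} (φ : Formula L α (m + n)) (x : Fin m → M) :
    IsGLB (Set.range fun y : Fin n → M => φ.value v (Fin.append x y))
      ((infTuple n φ).value v x) := by
  induction n with
  | zero =>
    have h : ∀ y : Fin 0 → M, Fin.append x y = x := fun y => by
      rw [Subsingleton.elim y Fin.elim0, Fin.append_elim0]; rfl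
    simp [h, infTuple]
  | succ n ih =>
    have hne : Nonempty M := LipStructure.nonempty L
    obtain ⟨b, hb⟩ := φ.exists_bound v
    have hbd : ∀ z, BddBelow (Set.range fun y : M => φ.value v (Fin.snoc z y)) := fun z =>
      ⟨-b, by rintro _ ⟨y, rfl⟩; exact (abs_le.1 (hb _)).1⟩
    obtain ⟨h1, h2⟩ := ih (.inf φ)
    refine ⟨?_, fun c hc => h2 ?_⟩
    · rintro _ ⟨y, rfl⟩
      refine (h1 ⟨Fin.init y, rfl⟩).trans ?_
      rw [← Fin.snoc_init_self y]
      simp only [value, Fin.append_snoc, Fin.init_snoc]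
      exact ciInf_le (hbd _) _
    · rintro _ ⟨y, rfl⟩
      simp only [value]
      refine le_ciInf fun z => ?_
      rw [← Fin.append_snoc]
      exact hc ⟨_, rfl⟩

/-- The formula `inf_y (r ψ(y) + d(x, y))`. For large `r` it approximates the distance to the zero
set of a nonnegative `ψ` from below. -/
def Formula.penalizedDist {n : ℕ} (r : ℝ) (ψ : Formula L Empty n) : Formula L Empty n :=
  infTuple n (.add (.smul r (ψ.relabel id (Fin.natAdd n)))
    (tupleMetric (fun i => .var (.inr (Fin.castAdd n i))) fun i => .var (.inr (Fin.natAdd n i))))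

theorem Formula.isGLB_penalizedDist {n : ℕ} (r : ℝ) (ψ : Formula L Empty n) (x : Fin n → M) :
    IsGLB (Set.range fun y => r * ψ.interp M y + tupleDist x y)
      ((penalizedDist r ψ).interp M x) := by
  rw [penalizedDist, interp]
  convert isGLB_infTuple (L := L) (fun e : Empty => (e.elim : M)) _ x using 3 with y
  simp only [interp, value, value_relabel, value_tupleMetric, termValue, Sum.elim_inr,
    Fin.append_left, Fin.append_right]
  congr 3
  funext i
  exact (Fin.append_right x y i).symm

end AffineFormula

/-! ### Metric on tuples -/

section Tuple

variable {M : Type w} [MetricSpace M] {n : ℕ}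

theorem tupleDist_nonneg (x y : Fin n → M) : 0 ≤ tupleDist x y :=
  Finset.sum_nonneg fun _ _ => dist_nonneg

theorem tupleDist_self (x : Fin n → M) : tupleDist x x = 0 := by
  simp [tupleDist]

theorem tupleDist_triangle (x y z : Fin n → M) :
    tupleDist x z ≤ tupleDist x y + tupleDist y z := by
  simp only [tupleDist, ← Finset.sum_add_distrib]
  exact Finset.sum_le_sum fun i _ => dist_triangle _ _ _

theorem dist_le_tupleDist (x y : Fin n → M) : dist x y ≤ tupleDist x y :=
  (dist_pi_le_iff (tupleDist_nonneg x y)).2 fun i =>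
    Finset.single_le_sum (f := fun i => dist (x i) (y i)) (fun _ _ => dist_nonneg)
      (Finset.mem_univ i)

theorem tupleDist_le_mul_dist (x y : Fin n → M) : tupleDist x y ≤ n * dist x y := by
  refine (Finset.sum_le_sum fun i _ => dist_le_pi_dist x y i).trans ?_
  simp

theorem tupleDist_le_card (L : LipschitzLanguage.{u, v}) [LipStructure L M] (x y : Fin n → M) :
    tupleDist x y ≤ n := by
  refine (Finset.sum_le_sum fun i _ => LipStructure.dist_le_one L (x i) (y i)).trans ?_
  simp

variable {D : Set (Fin n → M)}

theorem distTo_le {x y : Fin n → M} (hy : y ∈ D) : distTo D x ≤ tupleDist x y := by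
  rw [distTo, if_pos ⟨y, hy⟩]
  exact ciInf_le (f := fun a : D => tupleDist x a)
    ⟨0, by rintro _ ⟨a, rfl⟩; exact tupleDist_nonneg _ _⟩ ⟨y, hy⟩

theorem le_distTo (hD : D.Nonempty) {x : Fin n → M} {c : ℝ} (h : ∀ y ∈ D, c ≤ tupleDist x y) :
    c ≤ distTo D x := by
  rw [distTo, if_pos hD]
  have := hD.to_subtype
  exact le_ciInf fun a => h a a.2

theorem distTo_nonneg (hD : D.Nonempty) (x : Fin n → M) : 0 ≤ distTo D x :=
  le_distTo hD fun _ _ => tupleDist_nonneg _ _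

theorem setOf_distTo_eq_zero (hD : D.Nonempty) (hc : IsClosed D) : {x | distTo D x = 0} = D := by
  ext x
  refine ⟨fun hx => ?_, fun hx =>
    le_antisymm ((distTo_le hx).trans_eq (tupleDist_self x)) (distTo_nonneg hD x)⟩
  rw [← hc.closure_eq, Metric.mem_closure_iff]
  intro ε hε
  by_contra! h
  have := le_distTo hD fun y hy => (h y hy).trans (dist_le_tupleDist x y)
  rw [Set.mem_ofPred_eq] at hx
  linarith

end Tuple

/-! ### Definable predicates -/

section DefinablePred

variable {L : LipschitzLanguage.{u, v}} {M : Type w} [MetricSpace M] [LipStructure L M] {n : ℕ}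
  {P : (Fin n → M) → ℝ}

theorem isDefinablePred_iff : IsDefinablePred L P ↔
    ∀ ε > 0, ∃ ψ : Formula L Empty n, ∀ x, |ψ.interp M x - P x| ≤ ε := by
  constructor
  · rintro ⟨φ, hφ⟩ ε hε
    obtain ⟨k, hk⟩ := (Metric.tendstoUniformly_iff.1 hφ ε hε).exists
    exact ⟨φ k, fun x => by rw [abs_sub_comm]; exact (hk x).le⟩
  · intro h
    choose φ hφ using fun k : ℕ => h (1 / ((k : ℝ) + 1)) Nat.one_div_pos_of_nat
    refine ⟨φ, Metric.tendstoUniformly_iff.2 fun ε hε => ?_⟩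
    filter_upwards [tendsto_one_div_add_atTop_nhds_zero_nat.eventually_lt_const hε] with k hk x
    rw [dist_comm, Real.dist_eq]
    exact (hφ k x).trans_lt hk

theorem IsDefinablePred.sub_const (hP : IsDefinablePred L P) (c : ℝ) :
    IsDefinablePred L fun x => P x - c := by
  rw [isDefinablePred_iff] at *
  intro ε hε
  obtain ⟨ψ, hψ⟩ := hP ε hε
  refine ⟨.add ψ (.smul (-c) .one), fun x => ?_⟩
  convert hψ x using 2
  simp only [Formula.interp, Formula.value]
  ring

theorem IsDefinablePred.neg (hP : IsDefinablePred L P) : IsDefinablePred L fun x => -P x := by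
  rw [isDefinablePred_iff] at *
  intro ε hε
  obtain ⟨ψ, hψ⟩ := hP ε hε
  refine ⟨.smul (-1) ψ, fun x => ?_⟩
  rw [← abs_neg]
  convert hψ x using 2
  simp only [Formula.interp, Formula.value]
  ring

theorem IsDefinablePred.exists_le (hP : IsDefinablePred L P) {ε : ℝ} (hε : 0 < ε) :
    ∃ ψ : Formula L Empty n, ∀ x, P x - ε ≤ ψ.interp M x ∧ ψ.interp M x ≤ P x := by
  obtain ⟨ψ, hψ⟩ := isDefinablePred_iff.1 (hP.sub_const (ε / 2)) (ε / 2) (half_pos hε)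
  refine ⟨ψ, fun x => ?_⟩
  have := abs_le.1 (hψ x)
  constructor <;> linarith

theorem IsDefinablePred.exists_bound (hP : IsDefinablePred L P) : ∃ b : ℝ, ∀ x, |P x| ≤ b := by
  obtain ⟨ψ, hψ⟩ := isDefinablePred_iff.1 hP 1 one_pos
  obtain ⟨b, hb⟩ := ψ.exists_bound (M := M) fun e => e.elim
  refine ⟨b + 1, fun x => ?_⟩
  have h1 := abs_le.1 (hψ x)
  have h2 := abs_le.1 (hb x)
  rw [Formula.interp] at h1
  exact abs_le.2 ⟨by linarith, by linarith⟩

end DefinablePred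

/-! ### Types and their realizations -/

section Types

variable {L : LipschitzLanguage.{u, v}} {M : Type w} [MetricSpace M] [LipStructure L M] {n : ℕ}

theorem tp_mem_typeSpace (A : Set M) (b : Fin n → M) : tp L A b ∈ typeSpace L A n :=
  ⟨rfl, fun _ _ => rfl, fun _ _ => rfl, fun _ _ h => h b⟩

theorem isClosed_typeSpace (A : Set M) (n : ℕ) : IsClosed (typeSpace L A n) := by
  have hc : ∀ φ : Formula L A n, Continuous fun p : Formula L A n → ℝ => p φ := continuous_apply
  simp only [typeSpace, Set.ofPred_and, Set.ofPred_forall]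
  refine (isClosed_eq (hc _) continuous_const).inter (IsClosed.inter ?_ (IsClosed.inter ?_ ?_))
  · exact isClosed_iInter fun φ => isClosed_iInter fun ψ => isClosed_eq (hc _) ((hc _).add (hc _))
  · exact isClosed_iInter fun r => isClosed_iInter fun φ =>
      isClosed_eq (hc _) (continuous_const.mul (hc _))
  · exact isClosed_iInter fun φ => isClosed_iInter fun ψ => isClosed_iInter fun _ =>
      isClosed_le (hc _) (hc _)

theorem apply_le_of_mem_typeSpace {A : Set M} {p : Formula L A n → ℝ} (hp : p ∈ typeSpace L A n)
    {φ ψ : Formula L A n} {c : ℝ}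
    (h : ∀ x : Fin n → M, φ.value Subtype.val x ≤ ψ.value Subtype.val x + c) : p φ ≤ p ψ + c := by
  have := hp.2.2.2 φ (.add ψ (.smul c .one)) fun x => by
    simpa only [Formula.value, mul_one] using h x
  rwa [hp.2.1, hp.2.2.1, hp.1, mul_one] at this

theorem isCompact_typeSpace (A : Set M) (n : ℕ) : IsCompact (typeSpace L A n) := by
  choose b hb using fun φ : Formula L A n => φ.exists_bound (M := M) Subtype.val
  refine (isCompact_univ_pi fun φ => isCompact_Icc (a := -b φ) (b := b φ)).of_isClosed_subset
    (isClosed_typeSpace A n) fun p hp φ _ => ?_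
  have h0 : p (.smul 0 .one) = 0 := by rw [hp.2.2.1, zero_mul]
  constructor
  · have := apply_le_of_mem_typeSpace hp (φ := .smul 0 .one) (ψ := φ) (c := b φ) fun x => by
      have := (abs_le.1 (hb φ x)).1
      simp only [Formula.value]; linarith
    linarith
  · have := apply_le_of_mem_typeSpace hp (φ := φ) (ψ := .smul 0 .one) (c := b φ) fun x => by
      have := (abs_le.1 (hb φ x)).2
      simp only [Formula.value]; linarith
    linarith

/-- The types `p` over `A` with `p(P) ≤ 0`, where `P` is a uniform limit of formulas; the value of
`p` at `P` is expressed through the formulas below `P`. -/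
def zeroTypes (L : LipschitzLanguage.{u, v}) [LipStructure L M] (A : Set M)
    (P : (Fin n → M) → ℝ) : Set (Formula L A n → ℝ) :=
  {p ∈ typeSpace L A n | ∀ χ : Formula L A n, (∀ x, χ.value Subtype.val x ≤ P x) → p χ ≤ 0}

variable {A : Set M} {P : (Fin n → M) → ℝ}

theorem isCompact_zeroTypes : IsCompact (zeroTypes L A P) := by
  refine (isCompact_typeSpace A n).inter_right
    (t := {p | ∀ χ : Formula L A n, (∀ x, χ.value Subtype.val x ≤ P x) → p χ ≤ 0}) ?_
  simp only [Set.ofPred_forall]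
  exact isClosed_iInter fun χ => isClosed_iInter fun _ =>
    isClosed_le (continuous_apply χ) continuous_const

theorem IsDefinablePred.exists_le_over (hP : IsDefinablePred L P) (A : Set M) {ε : ℝ}
    (hε : 0 < ε) : ∃ χ : Formula L A n,
      ∀ x, P x - ε ≤ χ.value Subtype.val x ∧ χ.value Subtype.val x ≤ P x := by
  obtain ⟨ψ, hψ⟩ := hP.exists_le hε
  refine ⟨ψ.relabel (fun e => e.elim) id, fun x => ?_⟩
  rw [Formula.value_relabel]
  convert hψ x using 3 <;> · rw [Formula.interp]; congr; funext e; exact e.elim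

/-- Since `P ≥ 0`, every type takes a nonnegative value at `P`, so the types vanishing at `P` form
a face. -/
theorem isExtreme_zeroTypes (hP : IsDefinablePred L P) (h0 : ∀ x, 0 ≤ P x) :
    IsExtreme ℝ (typeSpace L A n) (zeroTypes L A P) := by
  refine ⟨fun p hp => hp.1, ?_⟩
  rintro p₁ hp₁ p₂ hp₂ p hp ⟨s, t, hs, ht, hst, rfl⟩
  refine ⟨hp₁, fun χ hχ => ?_⟩
  have key : ∀ ε > 0, s * p₁ χ ≤ ε := by
    intro ε hε
    obtain ⟨χ', hχ'⟩ := hP.exists_le_over A hε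
    have h1 : p₁ χ ≤ p₁ χ' + ε := apply_le_of_mem_typeSpace hp₁ fun x => by
      linarith [hχ x, (hχ' x).1]
    have h2 : p₂ (.smul 0 .one) ≤ p₂ χ' + ε := apply_le_of_mem_typeSpace hp₂ fun x => by
      simp only [Formula.value]
      linarith [h0 x, (hχ' x).1]
    rw [hp₂.2.2.1, zero_mul] at h2
    have h3 : s * p₁ χ' + t * p₂ χ' ≤ 0 := hp.2 χ' fun x => (hχ' x).2
    calc s * p₁ χ ≤ s * (p₁ χ' + ε) := by gcongr
      _ ≤ s * ε + t * ε := by nlinarith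
      _ = ε := by rw [← add_mul, hst, one_mul]
  have : s * p₁ χ ≤ 0 := le_of_forall_pos_le_add fun ε hε => by linarith [key ε hε]
  exact nonpos_of_mul_nonpos_right this hs

/-- A formula attains its minimum over the zero set of `P` at an element of `M`: the face of types
vanishing at `P` has a face on which `δ` is minimal, and the latter has an extreme point. -/
theorem exists_realization_of_mem_zeroTypes (hsat : IsExtremallySaturated L M ℵ₀)
    (hA : A.Finite) (hP : IsDefinablePred L P) (h0 : ∀ x, 0 ≤ P x)
    {p : Formula L A n → ℝ} (hp : p ∈ zeroTypes L A P) (δ : Formula L A n) :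
    ∃ b : Fin n → M, P b = 0 ∧ δ.value Subtype.val b ≤ p δ := by
  let l : StrongDual ℝ (Formula L A n → ℝ) := -ContinuousLinearMap.proj δ
  let F : Set (Formula L A n → ℝ) := {q ∈ zeroTypes L A P | ∀ q' ∈ zeroTypes L A P, l q' ≤ l q}
  have hF : IsExposed ℝ (zeroTypes L A P) F := fun _ => ⟨l, rfl⟩
  have hne : F.Nonempty :=
    let ⟨q, hq, hmax⟩ := isCompact_zeroTypes.exists_isMaxOn ⟨p, hp⟩ l.continuous.continuousOn
    ⟨q, hq, hmax⟩
  obtain ⟨q, hq⟩ := (hF.isCompact isCompact_zeroTypes).extremePoints_nonempty hne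
  obtain ⟨b, rfl⟩ := hsat A (Cardinal.lt_aleph0_iff_set_finite.2 hA) n q
    (((isExtreme_zeroTypes hP h0).trans hF.isExtreme).extremePoints_subset_extremePoints hq)
  refine ⟨b, le_antisymm (le_of_forall_pos_le_add fun ε hε => ?_) (h0 b),
    neg_le_neg_iff.1 (hq.1.2 p hp)⟩
  obtain ⟨χ, hχ⟩ := hP.exists_le_over A hε
  have := hq.1.1.2 χ fun x => (hχ x).2
  have h' := (hχ b).1
  rw [tp] at this
  linarith

/-- Approximate solutions of `P(y) = 0`, `δ(y) ≤ r` accumulate at a type, and extremal saturation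
turns it into a solution in `M`. -/
theorem exists_eq_zero_and_le (hsat : IsExtremallySaturated L M ℵ₀)
    (hA : A.Finite) (hP : IsDefinablePred L P) (h0 : ∀ x, 0 ≤ P x) (δ : Formula L A n) {r : ℝ}
    {y : ℕ → Fin n → M} {c : ℕ → ℝ} (hy : Tendsto (fun k => P (y k)) atTop (𝓝 0))
    (hc : Tendsto c atTop (𝓝 r)) (hδ : ∀ k, δ.value Subtype.val (y k) ≤ c k) :
    ∃ b : Fin n → M, P b = 0 ∧ δ.value Subtype.val b ≤ r := by
  let U : Ultrafilter ℕ := hyperfilter ℕ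
  have hU : (U : Filter ℕ) ≤ atTop := Nat.hyperfilter_le_atTop
  obtain ⟨p, hp, hUp⟩ := (isCompact_typeSpace (L := L) A n).ultrafilter_le_nhds
    (U.map fun k : ℕ => tp L A (y k))
    (le_principal_iff.2 (mem_map.2 (Eventually.of_forall fun k : ℕ => tp_mem_typeSpace A (y k))))
  have hlim : ∀ φ : Formula L A n, Tendsto (fun k : ℕ => φ.value Subtype.val (y k)) U (𝓝 (p φ)) :=
    fun φ => tendsto_map'_iff.1 (((continuous_apply φ).tendsto p).mono_left hUp)
  have hpz : p ∈ zeroTypes L A P :=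
    ⟨hp, fun χ hχ => le_of_tendsto_of_tendsto' (hlim χ) (hy.mono_left hU) fun k => hχ _⟩
  obtain ⟨b, hb, hbδ⟩ := exists_realization_of_mem_zeroTypes hsat hA hP h0 hpz δ
  exact ⟨b, hb, hbδ.trans (le_of_tendsto_of_tendsto' (hlim δ) (hc.mono_left hU) hδ)⟩

theorem exists_eq_zero_and_tupleDist_le (hsat : IsExtremallySaturated L M ℵ₀)
    (hP : IsDefinablePred L P) (h0 : ∀ x, 0 ≤ P x) (a : Fin n → M) {r : ℝ}
    {y : ℕ → Fin n → M} {c : ℕ → ℝ} (hy : Tendsto (fun k => P (y k)) atTop (𝓝 0))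
    (hc : Tendsto c atTop (𝓝 r)) (hd : ∀ k, tupleDist a (y k) ≤ c k) :
    ∃ b : Fin n → M, P b = 0 ∧ tupleDist a b ≤ r := by
  let δ : Formula L (Set.range a) n :=
    .tupleMetric (fun i => .var (.inl ⟨a i, i, rfl⟩)) fun i => .var (.inr i)
  have hδ : ∀ x : Fin n → M, δ.value Subtype.val x = tupleDist a x := fun x => by
    simp only [δ, Formula.value_tupleMetric, termValue, Sum.elim_inl, Sum.elim_inr]
  simpa only [hδ] using
    exists_eq_zero_and_le hsat (Set.finite_range a) hP h0 δ hy hc (by simpa only [hδ] using hd)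

/-- A limit `a` of zeros is a zero: the infimum `0` of the distances from `a` to zeros is attained. -/
theorem isClosed_setOf_eq_zero (hsat : IsExtremallySaturated L M ℵ₀)
    (hP : IsDefinablePred L P) (h0 : ∀ x, 0 ≤ P x) : IsClosed {x | P x = 0} := by
  refine isClosed_of_closure_subset fun a ha => ?_
  obtain ⟨y, hy, hya⟩ := mem_closure_iff_seq_limit.1 ha
  have hlim : Tendsto (fun k => (n : ℝ) * dist a (y k)) atTop (𝓝 0) := by
    simpa using ((tendsto_const_nhds (x := a)).dist hya).const_mul (n : ℝ)
  obtain ⟨b, hb, hab⟩ := exists_eq_zero_and_tupleDist_le hsat hP h0 a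
    (by simp only [show ∀ k, P (y k) = 0 from hy, tendsto_const_nhds]) hlim
    fun k => tupleDist_le_mul_dist _ _
  rwa [show a = b from dist_le_zero.1 ((dist_le_tupleDist a b).trans hab)]

end Types

/-! ### Transfer to a compact model -/

section Transfer

variable {L : LipschitzLanguage.{u, v}} {T : Theory L} {n : ℕ}
  {M : Type w} [MetricSpace M] [LipStructure L M] {K : Type w} [MetricSpace K] [LipStructure L K]

/-- The bound `φ ≤ c` is the condition `-c ≤ inf_x (-φ)` on a sentence, so it transfers between
models of a complete theory. -/
theorem IsCompleteTheory.forall_interp_le_iff (hT : IsCompleteTheory.{u, v, w} T)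
    (hM : IsModel T M) (hK : IsModel T K) (φ : Formula L Empty n) (c : ℝ) :
    (∀ x, φ.interp M x ≤ c) ↔ ∀ x, φ.interp K x ≤ c := by
  let χ : Sentence L := .infTuple n (.smul (-1) (φ.relabel id (Fin.natAdd 0)))
  have key : ∀ (N : Type w) [MetricSpace N] [LipStructure L N],
      (∀ x, φ.interp N x ≤ c) ↔ -c ≤ χ.interp N Fin.elim0 := by
    intro N _ _
    rw [Formula.interp, le_isGLB_iff (Formula.isGLB_infTuple _ _ _), mem_lowerBounds]
    simp only [Set.forall_mem_range, Formula.value, Formula.value_relabel]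
    refine forall_congr' fun x => ?_
    have : (Fin.append Fin.elim0 x : Fin (0 + n) → N) ∘ Fin.natAdd 0 = x := by
      funext i
      simp
    rw [this, Formula.interp, Function.comp_id]
    constructor <;> intro <;> linarith
  obtain ⟨r, hr, -⟩ := hT χ
  rw [key M, key K, hr M hM, hr K hK]

/-- A bounded sequence of equi-Lipschitz formulas has a uniformly convergent subsequence in a
compact model by the Arzelà–Ascoli theorem, hence in all models: being uniformly Cauchy is
expressed by values of sentences. -/
theorem exists_subseq_tendstoUniformly [CompactSpace K] (hT : IsCompleteTheory.{u, v, w} T)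
    (hM : IsModel T M) (hK : IsModel T K) (φ : ℕ → Formula L Empty n) {b : ℝ} {C : ℝ≥0}
    (hb : ∀ k x, |(φ k).interp M x| ≤ b) (hC : ∀ k, LipschitzWith C ((φ k).interp K)) :
    ∃ s : ℕ → ℕ, StrictMono s ∧ ∃ g : (Fin n → M) → ℝ,
      TendstoUniformly (fun j x => (φ (s j)).interp M x) g atTop := by
  have hbK : ∀ k x, (φ k).interp K x ∈ Set.Icc (-b) b := by
    intro k x
    refine ⟨?_, (hT.forall_interp_le_iff hM hK (φ k) b).1 (fun x => (abs_le.1 (hb k x)).2) x⟩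
    have := (hT.forall_interp_le_iff hM hK (.smul (-1) (φ k)) b).1 (fun x => by
      have := (abs_le.1 (hb k x)).1
      simp only [Formula.interp, Formula.value] at *
      linarith) x
    simp only [Formula.interp, Formula.value] at *
    linarith
  let f : ℕ → BoundedContinuousFunction (Fin n → K) ℝ := fun k =>
    BoundedContinuousFunction.mkOfCompact ⟨(φ k).interp K, (hC k).continuous⟩
  have hcpt : IsCompact (closure (Set.range f)) := by
    refine BoundedContinuousFunction.arzela_ascoli (Set.Icc (-b) b) isCompact_Icc _ ?_ ?_
    · rintro _ x ⟨k, rfl⟩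
      exact hbK k x
    · refine (LipschitzWith.uniformEquicontinuous _ C ?_).equicontinuous
      rintro ⟨_, k, rfl⟩
      exact hC k
  obtain ⟨_, -, s, hs, hlim⟩ := hcpt.tendsto_subseq fun k => subset_closure (Set.mem_range_self k)
  have hcau : ∀ ε > 0, ∃ N, ∀ i ≥ N, ∀ j ≥ N, ∀ x,
      (φ (s i)).interp M x - (φ (s j)).interp M x ≤ ε := by
    intro ε hε
    obtain ⟨N, hN⟩ := Metric.cauchySeq_iff.1 hlim.cauchySeq ε hε
    refine ⟨N, fun i hi j hj x => ?_⟩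
    have := (hT.forall_interp_le_iff hM hK (.add (φ (s i)) (.smul (-1) (φ (s j)))) ε).2
      (fun x => ?_) x
    · simp only [Formula.interp, Formula.value] at *
      linarith
    · have h1 := (BoundedContinuousFunction.dist_coe_le_dist x).trans (hN i hi j hj).le
      have h2 := (le_abs_self _).trans (Real.dist_eq _ _ ▸ h1)
      change (φ (s i)).interp K x - (φ (s j)).interp K x ≤ ε at h2
      simp only [Formula.interp, Formula.value] at *
      linarith
  have hcau' : UniformCauchySeqOn (fun j x => (φ (s j)).interp M x) atTop Set.univ := by
    refine Metric.uniformCauchySeqOn_iff.2 fun ε hε => ?_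
    obtain ⟨N, hN⟩ := hcau (ε / 2) (half_pos hε)
    refine ⟨N, fun i hi j hj x _ => ?_⟩
    rw [Real.dist_eq]
    exact (abs_sub_le_iff.2 ⟨hN i hi j hj x, hN j hj i hi x⟩).trans_lt (half_lt_self hε)
  choose g hg using fun x => cauchySeq_tendsto_of_complete (hcau'.cauchySeq (Set.mem_univ x))
  exact ⟨s, hs, g, tendstoUniformlyOn_univ.1
    (hcau'.tendstoUniformlyOn_of_tendsto fun x _ => hg x)⟩

theorem Formula.lipschitzWith_penalizedDist (r : ℝ) (ψ : Formula L Empty n) :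
    LipschitzWith n ((penalizedDist r ψ).interp K) := by
  refine LipschitzWith.of_le_add_mul _ fun x x' => ?_
  rw [← sub_le_iff_le_add, le_isGLB_iff (isGLB_penalizedDist r ψ x'), mem_lowerBounds]
  rintro _ ⟨y, rfl⟩
  have h1 := (isGLB_penalizedDist r ψ x).1 ⟨y, rfl⟩
  have h2 := tupleDist_triangle x x' y
  have h3 := tupleDist_le_mul_dist x x'
  simp only [NNReal.coe_natCast] at *
  linarith

end Transfer

/-! ### Zero sets and end-sets -/

section ZeroSet

variable {L : LipschitzLanguage.{u, v}} {T : Theory L} {n : ℕ}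
  {M : Type w} [MetricSpace M] [LipStructure L M] {P : (Fin n → M) → ℝ}

/-- The formulas `inf_y (k P(y) + d(x, y))`, with `P` replaced by an approximating formula, are
bounded and equi-Lipschitz, so they converge uniformly along a subsequence; by extremal saturation
over the parameters `x` the limit is the distance to the zero set of `P`. -/
theorem isDefinablePred_distTo_setOf_eq_zero (hT : IsCompleteTheory.{u, v, w} T)
    (hK : HasCompactModel.{u, v, w} T) (hM : IsModel T M)
    (hsat : IsExtremallySaturated L M ℵ₀) (hP : IsDefinablePred L P) (h0 : ∀ x, 0 ≤ P x)
    (hne : {x | P x = 0}.Nonempty) : IsDefinablePred L (distTo {x | P x = 0}) := by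
  obtain ⟨K, _, _, _, hKT⟩ := hK
  -- The precision `(k + 1)⁻²` keeps the error small after multiplication by `k + 1`.
  choose ψ hψ using fun k : ℕ => hP.exists_le (ε := 1 / ((k : ℝ) + 1) ^ 2) (by positivity)
  have hψ' : ∀ (k : ℕ) y, ((k : ℝ) + 1) * P y - 1 / ((k : ℝ) + 1) ≤ (k + 1) * (ψ k).interp M y := by
    intro k y
    have hk : (0 : ℝ) < (k : ℝ) + 1 := by positivity
    calc ((k : ℝ) + 1) * P y - 1 / (k + 1) = (k + 1) * (P y - 1 / ((k : ℝ) + 1) ^ 2) := by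
          field_simp
      _ ≤ _ := by gcongr; exact (hψ k y).1
  let θ : ℕ → Formula L Empty n := fun k => .penalizedDist ((k : ℝ) + 1) (ψ k)
  have hθ := fun (k : ℕ) x => Formula.isGLB_penalizedDist (M := M) ((k : ℝ) + 1) (ψ k) x
  have hθ_le : ∀ k x, (θ k).interp M x ≤ distTo {x | P x = 0} x := by
    intro k x
    refine le_distTo hne fun y hy => ((hθ k x).1 ⟨y, rfl⟩).trans ?_
    have := (hψ k y).2
    rw [show P y = 0 from hy] at this
    have hk : (0 : ℝ) < (k : ℝ) + 1 := by positivity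
    dsimp only
    nlinarith
  have hone : ∀ k : ℕ, 1 / ((k : ℝ) + 1) ≤ 1 := fun k =>
    (div_le_one (by positivity)).2 (by linarith [(Nat.cast_nonneg k : (0 : ℝ) ≤ k)])
  have hdn : ∀ x, distTo {x | P x = 0} x ≤ n := fun x =>
    (distTo_le hne.some_mem).trans (tupleDist_le_card L _ _)
  have hbd : ∀ k x, |(θ k).interp M x| ≤ n + 1 := by
    intro k x
    refine abs_le.2 ⟨?_, by linarith [hθ_le k x, hdn x]⟩
    refine (le_isGLB_iff (hθ k x)).2 ?_
    rintro _ ⟨y, rfl⟩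
    have h1 := hψ' k y
    have h2 : 0 ≤ ((k : ℝ) + 1) * P y := mul_nonneg (by positivity) (h0 y)
    have h3 := hone k
    have h4 := tupleDist_nonneg x y
    have h5 : (0 : ℝ) ≤ n := n.cast_nonneg
    dsimp only
    linarith
  obtain ⟨s, hs, g, hg⟩ := exists_subseq_tendstoUniformly hT hM hKT θ hbd
    fun k => Formula.lipschitzWith_penalizedDist _ _
  suffices g = distTo {x | P x = 0} from ⟨fun j => θ (s j), this ▸ hg⟩
  funext a
  have hga : Tendsto (fun j => (θ (s j)).interp M a) atTop (𝓝 (g a)) := hg.tendsto_at a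
  refine le_antisymm (le_of_tendsto' hga fun j => hθ_le _ _) ?_
  have hex : ∀ k : ℕ, ∃ y, ((k : ℝ) + 1) * (ψ k).interp M y + tupleDist a y <
      (θ k).interp M a + 1 / ((k : ℝ) + 1) := by
    intro k
    by_contra! h
    have := (le_isGLB_iff (hθ k a)).2 (mem_lowerBounds.2 (Set.forall_mem_range.2 h))
    have hk : 0 < 1 / ((k : ℝ) + 1) := by positivity
    change _ ≤ (θ k).interp M a at this
    linarith
  choose y hy using hex
  have hy' : ∀ k : ℕ, ((k : ℝ) + 1) * P (y k) + tupleDist a (y k) ≤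
      (θ k).interp M a + 2 * (1 / ((k : ℝ) + 1)) := fun k => by
    linarith [hψ' k (y k), hy k]
  have h1 : Tendsto (fun j => 1 / ((s j : ℝ) + 1)) atTop (𝓝 0) :=
    tendsto_one_div_add_atTop_nhds_zero_nat.comp hs.tendsto_atTop
  have hy0 : Tendsto (fun j => P (y (s j))) atTop (𝓝 0) := by
    refine squeeze_zero (g := fun j => ((n : ℝ) + 2) * (1 / ((s j : ℝ) + 1))) (fun j => h0 _)
      (fun j => ?_) (by simpa using h1.const_mul ((n : ℝ) + 2))
    rw [mul_one_div, le_div_iff₀ (by positivity)]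
    linarith [hy' (s j), tupleDist_nonneg a (y (s j)), hθ_le (s j) a, hdn a, hone (s j)]
  obtain ⟨b, hb, hab⟩ := exists_eq_zero_and_tupleDist_le hsat hP h0 a hy0
    (c := fun j => (θ (s j)).interp M a + 2 * (1 / ((s j : ℝ) + 1)))
    (r := g a) (by simpa using hga.add (h1.const_mul 2)) fun j => by
      have : 0 ≤ ((s j : ℝ) + 1) * P (y (s j)) := mul_nonneg (by positivity) (h0 _)
      linarith [hy' (s j)]
  exact (distTo_le hb).trans hab

theorem isDefinableSet_iff_exists_eq_zero (hT : IsCompleteTheory.{u, v, w} T)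
    (hK : HasCompactModel.{u, v, w} T) (hM : IsModel T M)
    (hsat : IsExtremallySaturated L M ℵ₀) {D : Set (Fin n → M)} (hD : D.Nonempty) :
    IsDefinableSet L D ↔
      ∃ P : (Fin n → M) → ℝ, IsDefinablePred L P ∧ (∀ x, 0 ≤ P x) ∧ D = {x | P x = 0} := by
  constructor
  · rintro ⟨hc, hd⟩
    exact ⟨_, hd, distTo_nonneg hD, (setOf_distTo_eq_zero hD hc).symm⟩
  · rintro ⟨P, hP, h0, rfl⟩
    exact ⟨isClosed_setOf_eq_zero hsat hP h0,
      isDefinablePred_distTo_setOf_eq_zero hT hK hM hsat hP h0 hD⟩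

/-- A definable predicate attains its infimum, by extremal saturation over the empty set. -/
theorem IsDefinablePred.exists_eq_iInf (hsat : IsExtremallySaturated L M ℵ₀)
    (hP : IsDefinablePred L P) : ∃ x, P x = ⨅ y, P y := by
  have hne : Nonempty M := LipStructure.nonempty L
  obtain ⟨b, hb⟩ := hP.exists_bound
  have hbd : BddBelow (Set.range P) := ⟨-b, by rintro _ ⟨x, rfl⟩; exact (abs_le.1 (hb x)).1⟩
  choose y hy using fun k : ℕ => exists_lt_of_ciInf_lt (f := P)
    (lt_add_of_pos_right (⨅ y, P y) (Nat.one_div_pos_of_nat (α := ℝ) (n := k)))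
  obtain ⟨x, hx, -⟩ := exists_eq_zero_and_le (A := ∅) (P := fun x => P x - ⨅ y, P y) (y := y)
    hsat Set.finite_empty (hP.sub_const _) (fun x => sub_nonneg.2 (ciInf_le hbd x)) .one
    (squeeze_zero (fun k => sub_nonneg.2 (ciInf_le hbd _))
      (fun k => sub_le_iff_le_add'.2 (hy k).le) tendsto_one_div_add_atTop_nhds_zero_nat)
    (tendsto_const_nhds (x := (1 : ℝ))) fun k => le_rfl
  exact ⟨x, sub_eq_zero.1 hx⟩

theorem isEndSet_iff_exists_eq_iInf {D : Set (Fin n → M)} :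
    IsEndSet L D ↔
      ∃ P : (Fin n → M) → ℝ, IsDefinablePred L P ∧ D = {x | P x = ⨅ y, P y} := by
  constructor
  · rintro ⟨P, hP, h | h⟩
    · exact ⟨P, hP, h⟩
    · refine ⟨_, hP.neg, h.trans ?_⟩
      ext x
      have : ⨅ y, -P y = -⨆ y, P y := by
        rw [iInf, Real.sInf_def, ← Set.image_neg_eq_neg, ← Set.range_comp, iSup]
        simp [Function.comp_def]
      simp only [Set.mem_ofPred_eq, this, neg_inj]
  · rintro ⟨P, hP, h⟩
    exact ⟨P, hP, .inl h⟩

theorem nonempty_and_isDefinableSet_iff_isEndSet (hT : IsCompleteTheory.{u, v, w} T)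
    (hK : HasCompactModel.{u, v, w} T) (hM : IsModel T M)
    (hsat : IsExtremallySaturated L M ℵ₀) (D : Set (Fin n → M)) :
    (D.Nonempty ∧ IsDefinableSet L D) ↔ IsEndSet L D := by
  rw [isEndSet_iff_exists_eq_iInf]
  constructor
  · rintro ⟨hD, hdef⟩
    obtain ⟨P, hP, h0, rfl⟩ := (isDefinableSet_iff_exists_eq_zero hT hK hM hsat hD).1 hdef
    obtain ⟨x, hx⟩ := hD
    have : ⨅ y, P y = 0 := le_antisymm
      ((ciInf_le ⟨0, by rintro _ ⟨y, rfl⟩; exact h0 y⟩ x).trans_eq hx) (Real.iInf_nonneg h0)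
    exact ⟨P, hP, by rw [this]⟩
  · rintro ⟨P, hP, rfl⟩
    obtain ⟨b, hb⟩ := hP.exists_bound
    have hbd : BddBelow (Set.range P) := ⟨-b, by rintro _ ⟨x, rfl⟩; exact (abs_le.1 (hb x)).1⟩
    have hne : {x | P x = ⨅ y, P y}.Nonempty := hP.exists_eq_iInf hsat
    refine ⟨hne, (isDefinableSet_iff_exists_eq_zero hT hK hM hsat hne).2 ⟨_,
      hP.sub_const (⨅ y, P y), fun x => sub_nonneg.2 (ciInf_le hbd x), ?_⟩⟩
    simp only [sub_eq_zero]

end ZeroSet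

end AffineLogic

theorem mainTheorem4 {L : LipschitzLanguage.{u, v}} (T : Theory L)
    (hT : IsCompleteTheory.{u, v, w} T) (hK : HasCompactModel.{u, v, w} T)
    (M : Type w) [MetricSpace M] [LipStructure L M] (hM : IsModel T M)
    (hsat : IsExtremallySaturated L M Cardinal.aleph0) (n : ℕ) :
    (∀ D : Set (Fin n → M), D.Nonempty →
      (IsDefinableSet L D ↔
        ∃ P : (Fin n → M) → ℝ,
          IsDefinablePred L P ∧ (∀ x, 0 ≤ P x) ∧ D = {x | P x = 0})) ∧
    (∀ D : Set (Fin n → M), (D.Nonempty ∧ IsDefinableSet L D) ↔ IsEndSet L D) := by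
  exact ⟨fun D hD => isDefinableSet_iff_exists_eq_zero hT hK hM hsat hD,
    nonempty_and_isDefinableSet_iff_isEndSet hT hK hM hsat⟩
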